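/- Let $G$ be a finite, simple, connected, regular graph with vertex set $V$, $n=|V|$, adjacency matrix $A$, and $d+1$ distinct adjacency eigenvalues $\lambda_0>\lambda_1>\cdots>\lambda_d$, where $d\ge 1$. Let $\langle p,q\rangle_G=\frac1n\operatorname{tr}(p(A)q(A))$, and let $p_0,\dots,p_d$ be the predistance polynomials of $G$: the unique sequence of polynomials with $\deg p_i=i$, orthogonal with respect to $\langle\cdot,\cdot\rangle_G$, and normalized by $\langle p_i,p_i\rangle_G=p_i(\lambda_0)$. The preintersection numbers $\alpha_i,\beta_i,\gamma_i$ are the coefficients of the three-term recurrence $xp_i=\beta_{i-1}p_{i-1}+\alpha_ip_i+\gamma_{i+1}p_{i+1}$ ($0\le i\le d$, with $p_{-1}=p_{d+1}=0$, the identity being understood on the set of eigenvalues), so that $\alpha_i=\langle xp_i,p_i\rangle_G/\langle p_i,p_i\rangle_G$ for $0\le i\le d$ and $\gamma_i=\langle xp_{i-1},p_i\rangle_G/\langle p_i,p_i\rangle_G$ for $1\le i\le d$; put $\gamma_0=0$. Let $S_i(u)$ be the set of vertices at distance $i$ from $u$ (with $S_{-1}(u)=\emptyset$). For vertices $u,v$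 at distance $i$ let $c_i(u,v)=|S_{i-1}(u)\cap S_1(v)|$, $a_i(u,v)=|S_i(u)\cap S_1(v)|$, $b_i(u,v)=|S_{i+1}(u)\cap S_1(v)|$. The graph $G$ is distance-regular if, for every $i$, each of these three numbers is the same for all pairs $u,v$ at distance $i$. Let $\overline{a_{d-1}c_{d-1}}$ be the average of $a_{d-1}(u,v)\,c_{d-1}(u,v)$ over all ordered pairs $(u,v)$ of vertices at distance $d-1$. Assume that $G$ has girth $g\ge 2d-2$ (where $g=\infty$ if $G$ has no cycle). Then: (i) If $\alpha_{d-1}<\gamma_d$, then $\overline{a_{d-1}c_{d-1}}\ge \alpha_{d-1}\gamma_{d-1}$, with equality if and only if $G$ is distance-regular. (ii) If $\alpha_{d-1}>\gamma_d$, then $\overline{a_{d-1}c_{d-1}}\le \alpha_{d-1}\gamma_{d-1}$, with equality if and only if $G$ is distance-regular. (iii) If $\alpha_{d-1}=\gamma_d$, then $(A^d)_{uv}=\alpha_{d-1}\gamma_{d-1}$ for all vertices $u,v$ at distance $d-1$. -/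

import Mathlib

open Polynomial

noncomputable section

namespace PreInt

variable {V : Type*} [Fintype V] [DecidableEq V]

/-! Spectral side: predistance polynomials and preintersection numbers. -/

section Spectral

variable (G : SimpleGraph V) [DecidableRel G.Adj]

/-- The set of distinct (real) eigenvalues of the adjacency matrix. -/
def eigenvalueSet : Set ℝ := spectrum ℝ (G.adjMatrix ℝ)

/-- The largest eigenvalue `λ₀` (the eigenvalue set is finite, and nonempty when `V` is). -/
def topEigenvalue : ℝ := sSup (eigenvalueSet G)

/-- The scalar product `⟨p, q⟩_G = (1/n) tr (p(A) q(A))`. -/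
def scalarProd (p q : ℝ[X]) : ℝ :=
  (aeval (G.adjMatrix ℝ) p * aeval (G.adjMatrix ℝ) q).trace / (Fintype.card V : ℝ)

/-- The monic orthogonal polynomials for `⟨·,·⟩_G`, obtained by the Gram–Schmidt process from
`1, x, x², …`. With `d + 1` distinct eigenvalues only the indices `i ≤ d` are meaningful. -/
def monicOrtho (i : ℕ) : ℝ[X] :=
  X ^ i - ∑ j : Fin i,
    C (scalarProd G (X ^ i) (monicOrtho j) / scalarProd G (monicOrtho j) (monicOrtho j))
      * monicOrtho j
termination_by i
decreasing_by all_goals exact j.isLt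

/-- The predistance polynomial `p_i` (`i ≤ d`): the orthogonal polynomial of degree `i`, rescaled
so that `⟨p_i, p_i⟩_G = p_i(λ₀)`; the scaling factor is `q_i(λ₀) / ⟨q_i, q_i⟩_G` for the
monic orthogonal polynomial `q_i`. -/
def predistancePoly (i : ℕ) : ℝ[X] :=
  C ((monicOrtho G i).eval (topEigenvalue G) / scalarProd G (monicOrtho G i) (monicOrtho G i))
    * monicOrtho G i

/-- The preintersection number `α_i`: the coefficient of `p_i` in the expansion of `x p_i` in
the orthogonal system of predistance polynomials, that is, in
`x p_i = β_{i-1} p_{i-1} + α_i p_i + γ_{i+1} p_{i+1}`. -/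
def preAlpha (i : ℕ) : ℝ :=
  scalarProd G (X * predistancePoly G i) (predistancePoly G i) /
    scalarProd G (predistancePoly G i) (predistancePoly G i)

/-- The preintersection number `γ_i`: the coefficient of `p_i` in the expansion of `x p_{i-1}`
in the predistance polynomials, with the convention `γ_0 = 0`. -/
def preGamma : ℕ → ℝ
  | 0 => 0
  | i + 1 =>
    scalarProd G (X * predistancePoly G i) (predistancePoly G (i + 1)) /
      scalarProd G (predistancePoly G (i + 1)) (predistancePoly G (i + 1))

end Spectral

/-! Combinatorial side: intersection numbers and distance-regularity. -/

section Combinatorial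

variable (G : SimpleGraph V)

/-- The sphere `S_i(u)` (for connected `G`). -/
def sphere (i : ℕ) (u : V) : Finset V := Finset.univ.filter fun w => G.dist u w = i

/-- `c_i(u,v) = |S_{i-1}(u) ∩ S_1(v)|`, where `S_{-1}(u)` is empty. -/
def cNum : ℕ → V → V → ℕ
  | 0, _, _ => 0
  | i + 1, u, v => (sphere G i u ∩ sphere G 1 v).card

/-- `a_i(u,v) = |S_i(u) ∩ S_1(v)|`. -/
def aNum (i : ℕ) (u v : V) : ℕ := (sphere G i u ∩ sphere G 1 v).card

/-- `b_i(u,v) = |S_{i+1}(u) ∩ S_1(v)|`. -/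
def bNum (i : ℕ) (u v : V) : ℕ := (sphere G (i + 1) u ∩ sphere G 1 v).card

/-- `f_i` is well-defined: `f u v` is the same for all ordered pairs `u, v` at distance `i`. -/
def WellDefinedAt (i : ℕ) (f : V → V → ℕ) : Prop :=
  ∀ u v u' v' : V, G.dist u v = i → G.dist u' v' = i → f u v = f u' v'

/-- A (connected) graph is distance-regular if all intersection numbers are well-defined; for
`i` larger than the diameter the condition is void. -/
def IsDistanceRegular : Prop :=
  G.Connected ∧ ∀ i : ℕ, WellDefinedAt G i (cNum G i) ∧ WellDefinedAt G i (aNum G i) ∧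
    WellDefinedAt G i (bNum G i)

/-- The ordered pairs of vertices at distance `i`. -/
def distPairs (i : ℕ) : Finset (V × V) := Finset.univ.filter fun x => G.dist x.1 x.2 = i

/-- The average of `a_i(u,v) c_i(u,v)` over all ordered pairs `(u,v)` at distance `i`. -/
def avgAC (i : ℕ) : ℝ :=
  (∑ x ∈ distPairs G i, (aNum G i x.1 x.2 : ℝ) * (cNum G i x.1 x.2 : ℝ)) /
    ((distPairs G i).card : ℝ)

end Combinatorial

end PreInt

end

/-! Write `d = m + 2`, let `q_i` be the monic orthogonal polynomials, and let `c`, `a` stand for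
`c_{d-1}(u,v)`, `a_{d-1}(u,v)`. Girth at least `2m + 2` makes every ball look like a tree up to
radius `m`, so the tree polynomials give the distance matrices there. One step further, `q_{d-1}(A)`
has entry `c` at distance `d-1` and 0 elsewhere (`aeval_monicOrtho_succ`). Comparing its norm with
its row sums gives `∑ c² = γ_{d-1} ∑ c` (`sum_cNum_sq`).

The predistance polynomials sum to the Hoffman polynomial, whose value at `A` is the all-ones
matrix. At distance at least `d-1` only `p_{d-1}` and `p_d` contribute, so `q_d(A)` is known there,
and the three-term recurrence gives `(A q_{d-1}(A))_{uv} = (α_{d-1} - γ_d) c + γ_d γ_{d-1}` at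
distance `d-1`. Summing over such pairs, the left side double counts to `∑ a c`. Together with the
second moment identity this yields `avg(ac) - α_{d-1} γ_{d-1} = (γ_d - α_{d-1}) avg((c - γ_{d-1})²)
/ γ_{d-1}` (`avgAC_sub`), which settles both inequalities.

Equality means `c = γ_{d-1}` throughout; then `q_{d-1}(A)` is a multiple of the distance matrix, and
multiplying by `A` determines the remaining intersection numbers. For (iii), `x^d` and `x q_{d-1}`
differ only in degree below `d-1`, which is invisible at distance `d-1`. -/

noncomputable section

namespace PreInt

/-- Two distinct paths with common ends make the subgraph formed by their edges non-acyclic. Working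
in that subgraph forces every edge of the cycle to lie on `p` or `q`, which bounds its length. -/
lemma egirth_le_of_isPath_ne {V : Type*} {G : SimpleGraph V} {u v : V} {p q : G.Walk u v}
    (hp : p.IsPath) (hq : q.IsPath) (hne : p ≠ q) : G.egirth ≤ ((p.length + q.length : ℕ) : ℕ∞) := by
  classical
  set s : Set (Sym2 V) := {e | e ∈ p.edges ∨ e ∈ q.edges} with hs
  set H : SimpleGraph V := SimpleGraph.fromEdgeSet s with hH
  have hHG : H ≤ G := by
    intro a b hab
    rw [hH, SimpleGraph.fromEdgeSet_adj] at hab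
    rcases hab.1 with h | h
    · exact p.adj_of_mem_edges h
    · exact q.adj_of_mem_edges h
  have hmem : ∀ e ∈ G.edgeSet, e ∈ s → e ∈ H.edgeSet := by
    intro e he hes
    rw [hH, SimpleGraph.edgeSet_fromEdgeSet]
    exact ⟨hes, G.not_isDiag_of_mem_edgeSet he⟩
  have hpe : ∀ e ∈ p.edges, e ∈ H.edgeSet := fun e he =>
    hmem e (p.edges_subset_edgeSet he) (Or.inl he)
  have hqe : ∀ e ∈ q.edges, e ∈ H.edgeSet := fun e he =>
    hmem e (q.edges_subset_edgeSet he) (Or.inr he)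
  have hcyc : ¬ H.IsAcyclic := by
    intro hac
    have h := (hac.subsingleton_path u v).elim ⟨p.transfer H hpe, hp.transfer hpe⟩
      ⟨q.transfer H hqe, hq.transfer hqe⟩
    have h2 := congrArg (fun w : H.Path u v => (w : H.Walk u v).mapLe hHG) h
    simp only [SimpleGraph.Walk.mapLe] at h2
    apply hne
    apply SimpleGraph.Walk.ext_support
    have h3 := congrArg SimpleGraph.Walk.support h2
    simpa using h3
  obtain ⟨a, c, hc, -⟩ := SimpleGraph.exists_egirth_eq_length.2 hcyc
  refine (SimpleGraph.egirth_le_length (hc.mapLe hHG)).trans ?_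
  have h1 : c.edges.toFinset ⊆ p.edges.toFinset ∪ q.edges.toFinset := by
    intro e he
    have := c.edges_subset_edgeSet (List.mem_toFinset.1 he)
    rw [hH, SimpleGraph.edgeSet_fromEdgeSet] at this
    simpa [hs] using this.1
  have h2 := (Finset.card_le_card h1).trans (Finset.card_union_le _ _)
  rw [List.toFinset_card_of_nodup hc.edges_nodup] at h2
  have h3 := p.edges.toFinset_card_le
  have h4 := q.edges.toFinset_card_le
  rw [SimpleGraph.Walk.length_edges] at h2 h3 h4
  simp only [SimpleGraph.Walk.mapLe, SimpleGraph.Walk.length_map]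
  exact_mod_cast h2.trans (by omega)

variable {V : Type*} [Fintype V] [DecidableEq V]

/-! ### The trace form on polynomials -/

section SpectralLemmas

variable (G : SimpleGraph V) [DecidableRel G.Adj]

lemma scalarProd_comm (p q : ℝ[X]) : scalarProd G p q = scalarProd G q p := by
  rw [scalarProd, scalarProd, Matrix.trace_mul_comm]

lemma scalarProd_add_left (p p' q : ℝ[X]) :
    scalarProd G (p + p') q = scalarProd G p q + scalarProd G p' q := by
  simp [scalarProd, add_mul, add_div]

lemma scalarProd_sub_left (p p' q : ℝ[X]) :
    scalarProd G (p - p') q = scalarProd G p q - scalarProd G p' q := by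
  simp [scalarProd, sub_mul, sub_div]

lemma scalarProd_sub_right (p q q' : ℝ[X]) :
    scalarProd G p (q - q') = scalarProd G p q - scalarProd G p q' := by
  simp [scalarProd, mul_sub, sub_div]

lemma scalarProd_add_right (p q q' : ℝ[X]) :
    scalarProd G p (q + q') = scalarProd G p q + scalarProd G p q' := by
  simp [scalarProd, mul_add, add_div]

lemma scalarProd_C_mul_left (c : ℝ) (p q : ℝ[X]) :
    scalarProd G (C c * p) q = c * scalarProd G p q := by
  simp [scalarProd, mul_div_assoc, Algebra.algebraMap_eq_smul_one]

lemma scalarProd_C_mul_right (c : ℝ) (p q : ℝ[X]) :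
    scalarProd G p (C c * q) = c * scalarProd G p q := by
  rw [scalarProd_comm, scalarProd_C_mul_left, scalarProd_comm]

lemma scalarProd_sum_left {ι : Type*} (s : Finset ι) (f : ι → ℝ[X]) (q : ℝ[X]) :
    scalarProd G (∑ i ∈ s, f i) q = ∑ i ∈ s, scalarProd G (f i) q := by
  simp [scalarProd, Finset.sum_mul, Matrix.trace_sum, Finset.sum_div]

lemma scalarProd_mul_right (p q r : ℝ[X]) :
    scalarProd G p (r * q) = scalarProd G (r * p) q := by
  simp only [scalarProd, ← map_mul]
  rw [← mul_assoc, mul_comm p r]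

lemma aeval_adjMatrix_apply_comm (p : ℝ[X]) (u v : V) :
    aeval (G.adjMatrix ℝ) p u v = aeval (G.adjMatrix ℝ) p v u := by
  induction p using Polynomial.induction_on' with
  | add p q hp hq => simp [hp, hq]
  | monomial i a =>
    have h : (G.adjMatrix ℝ ^ i).IsSymm := G.isSymm_adjMatrix.pow i
    simp only [aeval_monomial, Algebra.algebraMap_eq_smul_one, smul_mul_assoc, one_mul,
      Matrix.smul_apply]
    rw [h.apply]

/-- As `q(A)` is symmetric, the trace form is the entrywise inner product. Positivity and
orthogonality by disjoint supports both come from this. -/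
lemma scalarProd_eq_sum (p q : ℝ[X]) :
    scalarProd G p q = (∑ u, ∑ v, aeval (G.adjMatrix ℝ) p u v * aeval (G.adjMatrix ℝ) q u v) /
      (Fintype.card V : ℝ) := by
  simp only [scalarProd, Matrix.trace, Matrix.diag, Matrix.mul_apply]
  simp_rw [fun u v => aeval_adjMatrix_apply_comm G q v u]

lemma scalarProd_self_nonneg (p : ℝ[X]) : 0 ≤ scalarProd G p p := by
  rw [scalarProd_eq_sum]
  exact div_nonneg (Finset.sum_nonneg fun u _ => Finset.sum_nonneg fun v _ => mul_self_nonneg _)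
    (Nat.cast_nonneg _)

lemma scalarProd_self_eq_zero [Nonempty V] {p : ℝ[X]} :
    scalarProd G p p = 0 ↔ aeval (G.adjMatrix ℝ) p = 0 := by
  have hn : (Fintype.card V : ℝ) ≠ 0 := by exact_mod_cast Fintype.card_ne_zero
  rw [scalarProd_eq_sum, div_eq_zero_iff, or_iff_left hn]
  refine ⟨fun h => ?_, fun h => by simp [h]⟩
  ext u v
  have h1 := (Finset.sum_eq_zero_iff_of_nonneg
    fun u _ => Finset.sum_nonneg fun v _ => mul_self_nonneg _).1 h u (Finset.mem_univ u)
  exact mul_self_eq_zero.1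
    ((Finset.sum_eq_zero_iff_of_nonneg fun v _ => mul_self_nonneg _).1 h1 v (Finset.mem_univ v))

variable {G}

lemma eigenvalueSet_finite : (eigenvalueSet G).Finite := Matrix.finite_real_spectrum

/-- By spectral mapping, a polynomial killing `A` vanishes at all `d + 1` eigenvalues. Hence the
form is definite in degree at most `d`. -/
lemma aeval_adjMatrix_ne_zero [Nonempty V] {d : ℕ} (heig : (eigenvalueSet G).ncard = d + 1)
    {p : ℝ[X]} (hp : p ≠ 0) (hdeg : p.natDegree ≤ d) : aeval (G.adjMatrix ℝ) p ≠ 0 := by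
  intro h0
  have hsub : eigenvalueSet G ⊆ (p.roots.toFinset : Set ℝ) := by
    intro μ hμ
    have h := spectrum.subset_polynomial_aeval (G.adjMatrix ℝ) p ⟨μ, hμ, rfl⟩
    rw [h0, spectrum.zero_eq] at h
    simpa [hp] using h
  have h1 := Set.ncard_le_ncard hsub (Finset.finite_toSet _)
  rw [heig, Set.ncard_coe_finset] at h1
  have := p.roots.toFinset_card_le
  have := p.card_roots'
  omega

lemma aeval_adjMatrix_eq_zero {p : ℝ[X]} (hp : ∀ μ ∈ eigenvalueSet G, p.eval μ = 0) :
    aeval (G.adjMatrix ℝ) p = 0 := by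
  have hA : IsSelfAdjoint (G.adjMatrix ℝ) := SimpleGraph.isHermitian_adjMatrix ℝ G
  rw [← cfc_polynomial p (G.adjMatrix ℝ) hA,
    cfc_congr (g := fun _ => (0 : ℝ)) (fun μ hμ => hp μ hμ)]
  exact cfc_const_zero ℝ _

end SpectralLemmas

lemma degree_C_mul_le (c : ℝ) (p : ℝ[X]) : (C c * p).degree ≤ p.degree := by
  rw [← smul_eq_C_mul]
  exact degree_smul_le c p

/-! ### Monic orthogonal polynomials -/

section Ortho

variable (G : SimpleGraph V) [DecidableRel G.Adj]

lemma monicOrtho_degree_sub_lt (i : ℕ) : (monicOrtho G i - X ^ i).degree < ((i : ℕ) : WithBot ℕ) := by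
  induction i using Nat.strong_induction_on with
  | _ i ih =>
    rw [monicOrtho, sub_sub_cancel_left, degree_neg]
    rw [← mem_degreeLT]
    refine Submodule.sum_mem _ fun j _ => mem_degreeLT.2 ?_
    have h1 : (monicOrtho G j).degree ≤ j := by
      have := (degree_add_le (monicOrtho G j - X ^ (j : ℕ)) (X ^ (j : ℕ)))
      rw [sub_add_cancel] at this
      exact this.trans (max_le (ih j j.isLt).le (degree_X_pow_le _))
    exact (degree_C_mul_le _ _).trans_lt (h1.trans_lt (Nat.cast_lt.2 j.isLt))

lemma monicOrtho_monic (i : ℕ) : (monicOrtho G i).Monic := by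
  have := monic_X_pow_add (monicOrtho_degree_sub_lt G i)
  rwa [add_sub_cancel] at this

lemma monicOrtho_degree (i : ℕ) : (monicOrtho G i).degree = i := by
  have := degree_add_eq_right_of_degree_lt
    ((monicOrtho_degree_sub_lt G i).trans_eq (degree_X_pow (R := ℝ) i).symm)
  rwa [sub_add_cancel, degree_X_pow] at this

lemma monicOrtho_natDegree (i : ℕ) : (monicOrtho G i).natDegree = i :=
  natDegree_eq_of_degree_eq_some (monicOrtho_degree G i)

variable {G} [Nonempty V] {d : ℕ} (heig : (eigenvalueSet G).ncard = d + 1)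
include heig

lemma scalarProd_monicOrtho_self_pos {i : ℕ} (hi : i ≤ d) :
    0 < scalarProd G (monicOrtho G i) (monicOrtho G i) := by
  refine lt_of_le_of_ne (scalarProd_self_nonneg G _) fun h => ?_
  exact aeval_adjMatrix_ne_zero heig (monicOrtho_monic G i).ne_zero
    ((monicOrtho_natDegree G i).trans_le hi) ((scalarProd_self_eq_zero G).1 h.symm)

lemma scalarProd_monicOrtho_of_lt {i j : ℕ} (hi : i ≤ d) (hj : j < i) :
    scalarProd G (monicOrtho G i) (monicOrtho G j) = 0 := by
  induction i using Nat.strong_induction_on generalizing j with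
  | _ i ih =>
    rw [monicOrtho, scalarProd_sub_left, scalarProd_sum_left, Finset.sum_eq_single ⟨j, hj⟩]
    · rw [scalarProd_C_mul_left,
        div_mul_cancel₀ _ (scalarProd_monicOrtho_self_pos heig (hj.le.trans hi)).ne', sub_self]
    · intro l _ hl
      have hl' : (l : ℕ) ≠ j := fun h => hl (Fin.ext h)
      rw [scalarProd_C_mul_left]
      rcases lt_or_gt_of_ne hl' with h | h
      · rw [scalarProd_comm G (monicOrtho G l) (monicOrtho G j), ih j hj (hj.le.trans hi) h, mul_zero]
      · rw [ih l l.isLt (l.isLt.le.trans hi) h, mul_zero]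
    · simp

omit heig [Nonempty V] in
lemma degree_sub_C_mul_monicOrtho_lt {i : ℕ} {p : ℝ[X]} (hp : p.degree < (i + 1 : ℕ)) :
    (p - C (p.coeff i) * monicOrtho G i).degree < i := by
  rw [degree_lt_iff_coeff_zero] at hp ⊢
  intro j hj
  rcases hj.eq_or_lt with rfl | hj
  · have h1 : (monicOrtho G i).coeff i = 1 := by
      have := monicOrtho_monic G i
      rwa [Monic, leadingCoeff, monicOrtho_natDegree] at this
    simp [h1]
  · rw [coeff_sub, coeff_C_mul, hp j hj,
      coeff_eq_zero_of_natDegree_lt ((monicOrtho_natDegree G i).trans_lt hj)]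
    simp

lemma scalarProd_monicOrtho_of_degree_lt {i : ℕ} (hi : i ≤ d) {p : ℝ[X]} (hpi : p.degree < i) :
    scalarProd G (monicOrtho G i) p = 0 := by
  obtain ⟨l, hl, hp⟩ : ∃ l : ℕ, l ≤ i ∧ p.degree < (l : WithBot ℕ) := ⟨i, le_rfl, hpi⟩
  clear hpi
  induction l generalizing p with
  | zero =>
    have : p = 0 := by
      rw [← degree_eq_bot]
      by_contra h
      rw [degree_eq_natDegree (by simpa using h)] at hp
      exact absurd hp (by simp)
    simp [this, scalarProd]
  | succ l ih =>
    have h := ih (by omega) (degree_sub_C_mul_monicOrtho_lt (G := G) hp)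
    rwa [scalarProd_sub_right, scalarProd_C_mul_right, scalarProd_monicOrtho_of_lt heig hi hl,
      mul_zero, sub_zero] at h

/-- The difference of the two candidates has degree below `i`, so it is orthogonal to both of them
and hence to itself. -/
lemma eq_monicOrtho_of_orthogonal {i : ℕ} (hi : i ≤ d) {p : ℝ[X]}
    (hp : (p - X ^ i).degree < ((i : ℕ) : WithBot ℕ))
    (horth : ∀ q : ℝ[X], q.degree < i → scalarProd G p q = 0) : p = monicOrtho G i := by
  have hdeg : (p - monicOrtho G i).degree < i := by
    have : p - monicOrtho G i = (p - X ^ i) - (monicOrtho G i - X ^ i) := by ring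
    rw [this]
    exact (degree_sub_le _ _).trans_lt (max_lt hp (monicOrtho_degree_sub_lt G i))
  have h0 : scalarProd G (p - monicOrtho G i) (p - monicOrtho G i) = 0 := by
    rw [scalarProd_sub_left, horth _ hdeg, scalarProd_monicOrtho_of_degree_lt heig hi hdeg,
      sub_zero]
  by_contra hne
  refine aeval_adjMatrix_ne_zero heig (sub_ne_zero.2 hne) ?_ ((scalarProd_self_eq_zero G).1 h0)
  exact (natDegree_le_of_degree_le hdeg.le).trans hi

lemma degree_lt_of_scalarProd_eq_zero {i : ℕ} (hi : i ≤ d) {p : ℝ[X]}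
    (hp : p.degree < (i + 1 : ℕ)) (h0 : scalarProd G p (monicOrtho G i) = 0) : p.degree < i := by
  have h := scalarProd_monicOrtho_of_degree_lt heig hi (degree_sub_C_mul_monicOrtho_lt (G := G) hp)
  rw [scalarProd_sub_right, scalarProd_comm, h0, scalarProd_C_mul_right, zero_sub, neg_eq_zero,
    mul_eq_zero, or_iff_left (scalarProd_monicOrtho_self_pos heig hi).ne'] at h
  have := degree_sub_C_mul_monicOrtho_lt (G := G) hp
  simpa [h] using this

end Ortho

/-! ### Regular graphs: row sums and the largest eigenvalue -/

section Regular

variable {G : SimpleGraph V} [DecidableRel G.Adj] {k : ℕ} (hreg : G.IsRegularOfDegree k)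
include hreg

lemma lapMatrix_eq_of_regular : G.lapMatrix ℝ = (k : ℝ) • (1 : Matrix V V ℝ) - G.adjMatrix ℝ := by
  rw [SimpleGraph.lapMatrix, SimpleGraph.degMatrix, ← Matrix.diagonal_one, ← Matrix.diagonal_smul]
  congr 2
  ext v
  simp [hreg v]

lemma aeval_adjMatrix_row_sum (p : ℝ[X]) (u : V) :
    ∑ v, aeval (G.adjMatrix ℝ) p u v = p.eval (k : ℝ) := by
  induction p using Polynomial.induction_on' generalizing u with
  | add p q hp hq => simp [Finset.sum_add_distrib, hp, hq]
  | monomial i a =>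
    have h : ∀ u, ∑ v, (G.adjMatrix ℝ ^ i) u v = (k : ℝ) ^ i := by
      induction i with
      | zero => intro u; simp [Matrix.one_apply]
      | succ i ih =>
        intro u
        rw [pow_succ']
        simp_rw [SimpleGraph.adjMatrix_mul_apply]
        rw [Finset.sum_comm]
        simp [ih, hreg u, pow_succ']
    simp [aeval_monomial, Algebra.algebraMap_eq_smul_one, ← Finset.mul_sum, h]

lemma aeval_X_sub_C_degree : aeval (G.adjMatrix ℝ) (X - C (k : ℝ)) = - G.lapMatrix ℝ := by
  rw [lapMatrix_eq_of_regular hreg, ← Algebra.algebraMap_eq_smul_one, map_sub, aeval_X, aeval_C,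
    neg_sub]

variable [Nonempty V]

lemma degree_mem_eigenvalueSet : (k : ℝ) ∈ eigenvalueSet G := by
  rw [eigenvalueSet, spectrum.mem_iff, Algebra.algebraMap_eq_smul_one,
    ← lapMatrix_eq_of_regular hreg, Matrix.isUnit_iff_isUnit_det, isUnit_iff_ne_zero, not_not,
    ← Matrix.exists_mulVec_eq_zero_iff]
  exact ⟨fun _ => 1, fun h => one_ne_zero (congrFun h (Classical.arbitrary V)),
    SimpleGraph.lapMatrix_mulVec_const_eq_zero G⟩

omit [Nonempty V] in
lemma le_degree_of_mem_eigenvalueSet {μ : ℝ} (hμ : μ ∈ eigenvalueSet G) : μ ≤ k := by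
  rw [eigenvalueSet, spectrum.mem_iff, Algebra.algebraMap_eq_smul_one,
    Matrix.isUnit_iff_isUnit_det, isUnit_iff_ne_zero, not_not,
    ← Matrix.exists_mulVec_eq_zero_iff] at hμ
  obtain ⟨x, hx, h⟩ := hμ
  have h1 := (SimpleGraph.posSemidef_lapMatrix ℝ G).dotProduct_mulVec_nonneg x
  have h2 : G.lapMatrix ℝ = ((k : ℝ) - μ) • (1 : Matrix V V ℝ) +
      (μ • (1 : Matrix V V ℝ) - G.adjMatrix ℝ) := by
    rw [lapMatrix_eq_of_regular hreg, sub_smul]; abel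
  rw [h2, Matrix.add_mulVec, h, add_zero, Matrix.smul_mulVec, Matrix.one_mulVec,
    dotProduct_smul, star_trivial, smul_eq_mul] at h1
  have h3 : 0 < x ⬝ᵥ x := by
    refine lt_of_le_of_ne (Finset.sum_nonneg fun i _ => mul_self_nonneg _) fun h => hx ?_
    exact dotProduct_self_eq_zero.1 h.symm
  nlinarith

lemma topEigenvalue_eq : topEigenvalue G = k :=
  IsGreatest.csSup_eq
    ⟨degree_mem_eigenvalueSet hreg, fun _ => le_degree_of_mem_eigenvalueSet hreg⟩

/-- As the Laplacian `k - A` is positive semidefinite, `⟨(x - k) r, r⟩ = 0` forces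
`(A - k) r(A) = 0`. -/
lemma aeval_X_sub_C_mul_eq_zero {r : ℝ[X]}
    (h : scalarProd G ((X - C (k : ℝ)) * r) r = 0) :
    aeval (G.adjMatrix ℝ) ((X - C (k : ℝ)) * r) = 0 := by
  set R := aeval (G.adjMatrix ℝ) r with hR
  have hRt : R.conjTranspose = R := by
    ext u v
    simp only [Matrix.conjTranspose_apply, star_trivial]
    exact aeval_adjMatrix_apply_comm G r v u
  have hpsd := (SimpleGraph.posSemidef_lapMatrix ℝ G).conjTranspose_mul_mul_same R
  have htr : (R.conjTranspose * G.lapMatrix ℝ * R).trace = 0 := by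
    rw [scalarProd, map_mul, aeval_X_sub_C_degree hreg, ← hR, Matrix.neg_mul, Matrix.neg_mul,
      Matrix.trace_neg, div_eq_zero_iff, neg_eq_zero,
      or_iff_left (by exact_mod_cast Fintype.card_ne_zero)] at h
    rw [hRt, mul_assoc, Matrix.trace_mul_comm, h]
  rw [hpsd.trace_eq_zero_iff] at htr
  rw [map_mul, aeval_X_sub_C_degree hreg, ← hR, Matrix.neg_mul, neg_eq_zero]
  ext u v
  have h0 := congrFun (congrFun htr v) v
  -- The diagonal entries of `Rᵀ L R` are the Laplacian quadratic forms of the columns of `R`;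
  -- semidefiniteness then puts each column in the kernel of `L`.
  have h1 : star (fun w => R w v) ⬝ᵥ (G.lapMatrix ℝ).mulVec (fun w => R w v) = 0 := by
    rw [← Matrix.zero_apply (α := ℝ) v v, ← h0, mul_assoc, Matrix.mul_apply]
    rfl
  rw [(SimpleGraph.posSemidef_lapMatrix ℝ G).dotProduct_mulVec_zero_iff] at h1
  exact congrFun h1 u

end Regular

/-! ### The Hoffman polynomial -/

section Hoffman

variable {G : SimpleGraph V} [DecidableRel G.Adj] {k d : ℕ} (hreg : G.IsRegularOfDegree k)
  [Nonempty V] (heig : (eigenvalueSet G).ncard = d + 1)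
include hreg heig

/-- If `q_i = (x - k) r`, then `r` has degree below `i`, so `⟨(x - k) r, r⟩ = 0`; by
semidefiniteness `q_i(A) = 0`, which is impossible for `i ≤ d`. -/
lemma eval_monicOrtho_ne_zero {i : ℕ} (hi : i ≤ d) : (monicOrtho G i).eval (k : ℝ) ≠ 0 := by
  intro h
  obtain ⟨r, hr⟩ := dvd_iff_isRoot.2 h
  have hr0 : r ≠ 0 := by
    rintro rfl
    exact (monicOrtho_monic G i).ne_zero (by rw [hr, mul_zero])
  have hdeg : r.degree < i := by
    have := monicOrtho_natDegree G i
    rw [hr, natDegree_mul (X_sub_C_ne_zero _) hr0, natDegree_X_sub_C] at this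
    rw [degree_eq_natDegree hr0]
    exact_mod_cast (by omega : r.natDegree < i)
  have h0 := scalarProd_monicOrtho_of_degree_lt heig hi hdeg
  rw [hr] at h0
  refine aeval_adjMatrix_ne_zero heig (monicOrtho_monic G i).ne_zero
    ((monicOrtho_natDegree G i).trans_le hi) ?_
  rw [hr]
  exact aeval_X_sub_C_mul_eq_zero hreg h0

omit hreg [Nonempty V] heig in
variable (G) in
/-- The factor turning the monic orthogonal polynomial into the predistance polynomial. -/
def predistanceScale (i : ℕ) : ℝ :=
  (monicOrtho G i).eval (topEigenvalue G) / scalarProd G (monicOrtho G i) (monicOrtho G i)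

omit hreg [Nonempty V] heig in
lemma predistancePoly_eq (i : ℕ) :
    predistancePoly G i = C (predistanceScale G i) * monicOrtho G i := rfl

lemma predistanceScale_ne_zero {i : ℕ} (hi : i ≤ d) : predistanceScale G i ≠ 0 := by
  rw [predistanceScale, topEigenvalue_eq hreg]
  exact div_ne_zero (eval_monicOrtho_ne_zero hreg heig hi)
    (scalarProd_monicOrtho_self_pos heig hi).ne'

lemma scalarProd_predistancePoly_monicOrtho {i : ℕ} (hi : i ≤ d) :
    scalarProd G (predistancePoly G i) (monicOrtho G i) = (monicOrtho G i).eval (k : ℝ) := by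
  rw [predistancePoly_eq, scalarProd_C_mul_left, predistanceScale, topEigenvalue_eq hreg,
    div_mul_cancel₀ _ (scalarProd_monicOrtho_self_pos heig hi).ne']

omit hreg in
lemma scalarProd_predistancePoly_of_degree_lt {i : ℕ} (hi : i ≤ d) {p : ℝ[X]}
    (hp : p.degree < i) : scalarProd G (predistancePoly G i) p = 0 := by
  rw [predistancePoly_eq, scalarProd_C_mul_left, scalarProd_monicOrtho_of_degree_lt heig hi hp,
    mul_zero]

omit hreg heig [Nonempty V] in
lemma degree_predistancePoly_le (i : ℕ) : (predistancePoly G i).degree ≤ i :=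
  (degree_C_mul_le _ _).trans (monicOrtho_degree G i).le

omit hreg heig [Nonempty V] in
lemma degree_sum_predistancePoly_lt (i : ℕ) :
    (∑ j ∈ Finset.range i, predistancePoly G j).degree < i := by
  rw [← mem_degreeLT]
  refine Submodule.sum_mem _ fun j hj => mem_degreeLT.2 ?_
  exact (degree_predistancePoly_le j).trans_lt (Nat.cast_lt.2 (Finset.mem_range.1 hj))

/-- The normalization amounts to `⟨p_j, q_j⟩ = q_j(k)`, so the partial sums are reproducing kernels
for evaluation at `k`. -/
lemma scalarProd_sum_predistancePoly_of_degree_lt {i : ℕ} (hi : i ≤ d + 1) {q : ℝ[X]}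
    (hq : q.degree < i) :
    scalarProd G (∑ j ∈ Finset.range i, predistancePoly G j) q = q.eval (k : ℝ) := by
  induction i generalizing q with
  | zero =>
    have : q = 0 := by
      rw [← degree_eq_bot]
      by_contra h
      rw [degree_eq_natDegree (by simpa using h)] at hq
      exact absurd hq (by simp)
    simp [this, scalarProd]
  | succ i ih =>
    have hi' : i ≤ d := by omega
    have hq' := degree_sub_C_mul_monicOrtho_lt (G := G) hq
    obtain ⟨r, hr⟩ : ∃ r, r = q - C (q.coeff i) * monicOrtho G i := ⟨_, rfl⟩
    rw [← hr] at hq'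
    rw [show q = r + C (q.coeff i) * monicOrtho G i by rw [hr]; ring,
      Finset.sum_range_succ, scalarProd_add_left, scalarProd_add_right, scalarProd_add_right,
      ih (by omega) hq', scalarProd_C_mul_right, scalarProd_C_mul_right,
      scalarProd_predistancePoly_monicOrtho hreg heig hi',
      scalarProd_predistancePoly_of_degree_lt heig hi' hq', scalarProd_comm,
      scalarProd_monicOrtho_of_degree_lt heig hi' (degree_sum_predistancePoly_lt i)]
    simp

/-- Reduction modulo the product of `x - μ` over the eigenvalues changes neither side, so the degree
bound can be dropped. -/
lemma scalarProd_sum_predistancePoly (q : ℝ[X]) :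
    scalarProd G (∑ j ∈ Finset.range (d + 1), predistancePoly G j) q = q.eval (k : ℝ) := by
  set m : ℝ[X] := ∏ μ ∈ (eigenvalueSet_finite (G := G)).toFinset, (X - C μ) with hm
  have hmon : m.Monic := monic_prod_of_monic _ _ fun μ _ => monic_X_sub_C μ
  have hroot : ∀ μ ∈ eigenvalueSet G, m.eval μ = 0 := by
    intro μ hμ
    rw [hm, eval_prod]
    exact Finset.prod_eq_zero ((eigenvalueSet_finite (G := G)).mem_toFinset.2 hμ) (by simp)
  have hdeg : m.degree = (d + 1 : ℕ) := by
    rw [hm, degree_prod]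
    simp [← Set.ncard_eq_toFinset_card _ (eigenvalueSet_finite (G := G)), heig]
  have hq : (q %ₘ m).degree < (d + 1 : ℕ) := hdeg ▸ degree_modByMonic_lt q hmon
  have h1 : q.eval (k : ℝ) = (q %ₘ m).eval (k : ℝ) := by
    conv_lhs => rw [← modByMonic_add_div q m]
    simp [hroot _ (degree_mem_eigenvalueSet hreg)]
  rw [h1, ← scalarProd_sum_predistancePoly_of_degree_lt hreg heig le_rfl hq]
  conv_lhs => rw [← modByMonic_add_div q m]
  rw [scalarProd_add_right, add_eq_left, scalarProd, map_mul, aeval_adjMatrix_eq_zero hroot]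
  simp

/-- The sum of the predistance polynomials is the Hoffman polynomial. -/
lemma aeval_sum_predistancePoly (hconn : G.Connected) (u v : V) :
    aeval (G.adjMatrix ℝ) (∑ j ∈ Finset.range (d + 1), predistancePoly G j) u v = 1 := by
  set H := ∑ j ∈ Finset.range (d + 1), predistancePoly G j with hH
  -- The squared norm of `(x - k) H` equals `⟨H, (x - k)² H⟩`, the value at `k` of a multiple of `x
  -- - k`.
  have h0 : aeval (G.adjMatrix ℝ) ((X - C (k : ℝ)) * H) = 0 := by
    rw [← scalarProd_self_eq_zero, ← scalarProd_mul_right, hH,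
      scalarProd_sum_predistancePoly hreg heig]
    simp
  -- The columns of `H(A)` lie in the Laplacian kernel, so they are constant by connectedness;
  -- symmetry then makes the whole matrix constant, and `⟨H, 1⟩ = 1` fixes the constant.
  have hcol : ∀ u u' v, aeval (G.adjMatrix ℝ) H u v = aeval (G.adjMatrix ℝ) H u' v := by
    intro u u' v
    have h1 : (G.lapMatrix ℝ).mulVec (fun w => aeval (G.adjMatrix ℝ) H w v) = 0 := by
      rw [map_mul, aeval_X_sub_C_degree hreg, Matrix.neg_mul, neg_eq_zero] at h0
      ext w
      exact congrFun (congrFun h0 w) v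
    exact (G.lapMatrix_mulVec_eq_zero_iff_forall_reachable.1 h1) u u' (hconn u u')
  have hconst : ∀ w, aeval (G.adjMatrix ℝ) H w w = aeval (G.adjMatrix ℝ) H u v := fun w => by
    rw [hcol w u w, aeval_adjMatrix_apply_comm, hcol w v u, aeval_adjMatrix_apply_comm]
  have h2 := scalarProd_sum_predistancePoly hreg heig 1
  rw [← hH, scalarProd, map_one, mul_one, Matrix.trace] at h2
  simp only [Matrix.diag, hconst, Finset.sum_const, Finset.card_univ, nsmul_eq_mul, eval_one] at h2
  rwa [mul_div_cancel_left₀ _ (by exact_mod_cast Fintype.card_ne_zero)] at h2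

end Hoffman

/-! ### Polynomial degree versus distance -/

section Distance

variable {G : SimpleGraph V} [DecidableRel G.Adj]

lemma aeval_adjMatrix_apply_eq_zero {p : ℝ[X]} {u v : V} (hp : p.degree < (G.dist u v : ℕ)) :
    aeval (G.adjMatrix ℝ) p u v = 0 := by
  rw [aeval_eq_sum_range, Matrix.sum_apply]
  refine Finset.sum_eq_zero fun i _ => ?_
  rw [Matrix.smul_apply, smul_eq_mul]
  by_cases hi : i < G.dist u v
  · have : (G.adjMatrix ℝ ^ i) u v = 0 := by
      rw [SimpleGraph.adjMatrix_pow_apply_eq_card_walk, Nat.cast_eq_zero, Fintype.card_eq_zero_iff]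
      exact ⟨fun p => absurd (SimpleGraph.dist_le p.1) (by rw [p.2]; omega)⟩
    rw [this, mul_zero]
  · rw [coeff_eq_zero_of_degree_lt (hp.trans_le (by exact_mod_cast not_lt.1 hi)), zero_mul]

/-- At distance beyond `d` the Hoffman polynomial, of degree at most `d`, would have entry 0 instead
of 1. -/
lemma dist_le_of_ncard_eigenvalueSet {k d : ℕ} (hconn : G.Connected)
    (hreg : G.IsRegularOfDegree k) (heig : (eigenvalueSet G).ncard = d + 1) (u v : V) :
    G.dist u v ≤ d := by
  have : Nonempty V := ⟨u⟩
  by_contra! h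
  have h1 := aeval_sum_predistancePoly hreg heig hconn u v
  rw [aeval_adjMatrix_apply_eq_zero
    ((degree_sum_predistancePoly_lt (d + 1)).trans_le (by exact_mod_cast h))] at h1
  exact zero_ne_one h1

end Distance

/-! ### Spheres, intersection numbers and girth -/

section Spheres

variable {G : SimpleGraph V}

omit [DecidableEq V] in
lemma mem_sphere {i : ℕ} {u w : V} : w ∈ sphere G i u ↔ G.dist u w = i := by simp [sphere]

lemma mem_sphere_inter {i : ℕ} {u v w : V} :
    w ∈ sphere G i u ∩ sphere G 1 v ↔ G.dist u w = i ∧ G.Adj v w := by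
  simp [mem_sphere]

variable (hconn : G.Connected)
include hconn

omit [Fintype V] [DecidableEq V] in
lemma dist_le_succ_of_adj (u : V) {v w : V} (h : G.Adj v w) : G.dist u w ≤ G.dist u v + 1 := by
  have := hconn.dist_triangle (u := u) (v := v) (w := w)
  rwa [SimpleGraph.dist_eq_one_iff_adj.2 h] at this

lemma card_sphere_inter_eq_zero {i : ℕ} {u v : V}
    (h : i + 1 < G.dist u v ∨ G.dist u v + 1 < i) :
    (sphere G i u ∩ sphere G 1 v).card = 0 := by
  rw [Finset.card_eq_zero, Finset.eq_empty_iff_forall_notMem]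
  intro w hw
  rw [mem_sphere_inter] at hw
  have h1 := dist_le_succ_of_adj hconn u hw.2
  have h2 := dist_le_succ_of_adj hconn u hw.2.symm
  omega

lemma cNum_pos {i : ℕ} {u v : V} (h : G.dist u v = i + 1) : 0 < cNum G (i + 1) u v := by
  obtain ⟨p, hp⟩ := hconn.exists_walk_length_eq_dist v u
  cases p with
  | nil => simp at h
  | @cons _ w _ hadj p =>
    refine Finset.card_pos.2 ⟨w, mem_sphere_inter.2 ⟨?_, hadj⟩⟩
    rw [SimpleGraph.Walk.length_cons, SimpleGraph.dist_comm, h] at hp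
    have h1 := SimpleGraph.dist_le p
    have h2 := dist_le_succ_of_adj hconn u hadj.symm
    rw [SimpleGraph.dist_comm] at h1
    omega

omit [Fintype V] in
/-- A shortest walk from `u` to a neighbour `w` of `v`, read from `v`. -/
lemma exists_isPath_cons {u v w : V} (hadj : G.Adj v w) (hle : G.dist u w ≤ G.dist u v) :
    ∃ p : G.Walk w u, (SimpleGraph.Walk.cons hadj p).IsPath ∧ p.length = G.dist u w := by
  obtain ⟨p, hp⟩ := hconn.exists_walk_length_eq_dist w u
  refine ⟨p, ?_, hp.trans SimpleGraph.dist_comm⟩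
  rw [SimpleGraph.Walk.cons_isPath_iff]
  refine ⟨p.isPath_of_length_eq_dist hp, fun hv => ?_⟩
  have h1 := SimpleGraph.dist_le (p.dropUntil v hv)
  have h2 := congrArg SimpleGraph.Walk.length (p.take_spec hv)
  rw [SimpleGraph.Walk.length_append] at h2
  have h3 : 0 < (p.takeUntil v hv).length := by
    rw [Nat.pos_iff_ne_zero]
    exact fun h => hadj.ne (SimpleGraph.Walk.eq_of_length_eq_zero h).symm
  rw [SimpleGraph.dist_comm] at h1
  rw [SimpleGraph.dist_comm] at hp
  omega

/-- Two such neighbours of `v` would give distinct paths from `v` to `u` of total length `2i + 2 ≤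
2m`. -/
lemma cNum_eq_one {i m : ℕ} (hg : ((2 * m + 2 : ℕ) : ℕ∞) ≤ G.egirth) (hi : i + 1 ≤ m) {u v : V}
    (h : G.dist u v = i + 1) : cNum G (i + 1) u v = 1 := by
  refine le_antisymm (Finset.card_le_one.2 fun w hw w' hw' => ?_) (cNum_pos hconn h)
  rw [mem_sphere_inter] at hw hw'
  by_contra hne
  obtain ⟨p, hp, hpl⟩ := exists_isPath_cons hconn hw.2 (u := u) (by omega)
  obtain ⟨q, hq, hql⟩ := exists_isPath_cons hconn hw'.2 (u := u) (by omega)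
  have h1 := hg.trans (egirth_le_of_isPath_ne hp hq fun heq => hne (by
    injection heq))
  rw [Nat.cast_le] at h1
  simp only [SimpleGraph.Walk.length_cons] at h1
  omega

/-- A neighbour at the same distance would give paths of lengths `i` and `i + 1`, of total length at
most `2m + 1`. -/
lemma aNum_eq_zero {i m : ℕ} (hg : ((2 * m + 2 : ℕ) : ℕ∞) ≤ G.egirth) (hi : i ≤ m) {u v : V}
    (h : G.dist u v = i) : aNum G i u v = 0 := by
  rw [aNum, Finset.card_eq_zero, Finset.eq_empty_iff_forall_notMem]
  intro w hw
  rw [mem_sphere_inter] at hw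
  obtain ⟨p, hp, hpl⟩ := exists_isPath_cons hconn hw.2 (u := u) (by omega)
  obtain ⟨q, hq, hql⟩ := hconn.exists_path_of_dist v u
  rw [SimpleGraph.dist_comm] at hql
  have hne : SimpleGraph.Walk.cons hw.2 p ≠ q := by
    rintro rfl
    rw [SimpleGraph.Walk.length_cons] at hql
    omega
  have h1 := hg.trans (egirth_le_of_isPath_ne hp hq hne)
  rw [Nat.cast_le, SimpleGraph.Walk.length_cons] at h1
  omega

variable [DecidableRel G.Adj] {k : ℕ} (hreg : G.IsRegularOfDegree k)
include hreg

lemma cNum_add_aNum_add_bNum {i : ℕ} {u v : V} (h : G.dist u v = i) :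
    cNum G i u v + aNum G i u v + bNum G i u v = k := by
  have hN : ∀ w, w ∈ G.neighborFinset v ↔ G.Adj v w := fun w => by simp
  have hk : (G.neighborFinset v).card = k := hreg v
  have hc : cNum G i u v = ((G.neighborFinset v).filter fun w => G.dist u w + 1 = i).card := by
    cases i with
    | zero => simp [cNum]
    | succ i =>
      rw [cNum]
      congr 1
      ext w
      rw [mem_sphere_inter, Finset.mem_filter, SimpleGraph.mem_neighborFinset,
        Nat.add_right_cancel_iff]
      tauto
  have ha : aNum G i u v = ((G.neighborFinset v).filter fun w => G.dist u w = i).card := by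
    rw [aNum]
    congr 1
    ext w
    rw [mem_sphere_inter, Finset.mem_filter, SimpleGraph.mem_neighborFinset]
    tauto
  have hb : bNum G i u v = ((G.neighborFinset v).filter fun w => G.dist u w = i + 1).card := by
    rw [bNum]
    congr 1
    ext w
    rw [mem_sphere_inter, Finset.mem_filter, SimpleGraph.mem_neighborFinset]
    tauto
  rw [hc, ha, hb, ← hk, ← Finset.card_union_of_disjoint, ← Finset.card_union_of_disjoint]
  · congr 1
    ext w
    simp only [Finset.mem_union, Finset.mem_filter, hN]
    refine ⟨by tauto, fun hw => ?_⟩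
    have h1 := dist_le_succ_of_adj hconn u hw
    have h2 := dist_le_succ_of_adj hconn u hw.symm
    have h3 : G.dist u w + 1 = i ∨ G.dist u w = i ∨ G.dist u w = i + 1 := by omega
    tauto
  · rw [Finset.disjoint_left]
    simp only [Finset.mem_union, Finset.mem_filter]
    rintro w (⟨-, hw⟩ | ⟨-, hw⟩) ⟨-, hw'⟩ <;> omega
  · rw [Finset.disjoint_left]
    simp only [Finset.mem_filter]
    rintro w ⟨-, hw⟩ ⟨-, hw'⟩
    omega

end Spheres

/-! ### Tree polynomials and graphs of large girth -/

section TreePoly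

/-- The distance polynomials of the infinite `k`-regular tree. -/
def treePoly (k : ℕ) : ℕ → ℝ[X]
  | 0 => 1
  | 1 => X
  | i + 2 => X * treePoly k (i + 1) - C (if i = 0 then (k : ℝ) else k - 1) * treePoly k i

/-- Because the recurrence has no `α` term, the coefficient of `x^(i-1)` vanishes. This extra degree
is what part (iii) uses. -/
lemma treePoly_sub_X_pow_degree_lt (k i : ℕ) :
    (treePoly k i - X ^ i).degree < ((i - 1 : ℕ) : WithBot ℕ) := by
  induction i using Nat.strong_induction_on with
  | _ i ih =>
    match i with
    | 0 => simp [treePoly]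
    | 1 => simp [treePoly]
    | i + 2 =>
      have h1 := ih (i + 1) (by omega)
      have h2 := ih i (by omega)
      have h3 : (treePoly k i).degree ≤ i := by
        have := degree_add_le (treePoly k i - X ^ i) (X ^ i)
        rw [sub_add_cancel] at this
        refine this.trans (max_le (h2.le.trans ?_) (degree_X_pow_le _))
        exact_mod_cast Nat.sub_le i 1
      have h4 : treePoly k (i + 2) - X ^ (i + 2) = X * (treePoly k (i + 1) - X ^ (i + 1)) -
          C (if i = 0 then (k : ℝ) else k - 1) * treePoly k i := by
        rw [treePoly]; ring
      rw [h4]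
      refine (degree_sub_le _ _).trans_lt (max_lt ?_ ?_)
      · rw [degree_lt_iff_coeff_zero] at h1 ⊢
        intro j hj
        obtain ⟨j, rfl⟩ : ∃ l, j = l + 1 := ⟨j - 1, by omega⟩
        rw [coeff_X_mul]
        exact h1 j (by omega)
      · exact (degree_C_mul_le _ _).trans_lt (h3.trans_lt (Nat.cast_lt.2 (by omega)))

variable {G : SimpleGraph V} [DecidableRel G.Adj]

lemma aeval_X_mul_apply_of_indicator {p : ℝ[X]} {i : ℕ} {u : V}
    (hp : ∀ w, aeval (G.adjMatrix ℝ) p u w = if G.dist u w = i then 1 else 0) (v : V) :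
    aeval (G.adjMatrix ℝ) (X * p) u v = ((sphere G i u ∩ sphere G 1 v).card : ℝ) := by
  rw [mul_comm, map_mul, aeval_X, SimpleGraph.mul_adjMatrix_apply]
  simp_rw [hp]
  rw [Finset.sum_boole]
  congr 2
  ext w
  rw [mem_sphere_inter, Finset.mem_filter, SimpleGraph.mem_neighborFinset, and_comm]

variable {k m : ℕ} (hconn : G.Connected) (hreg : G.IsRegularOfDegree k)
  (hg : ((2 * m + 2 : ℕ) : ℕ∞) ≤ G.egirth)
include hconn hreg hg

/-- The second claim turns into the first at the next index as long as `c = 1` is known. At `i = m`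
it reaches distance `m + 1 = d - 1`, where `c` is no longer controlled by the girth. -/
lemma aeval_treePoly_aux (i : ℕ) (hi : i ≤ m) :
    (∀ u v, aeval (G.adjMatrix ℝ) (treePoly k i) u v = if G.dist u v = i then 1 else 0) ∧
    ∀ u v, aeval (G.adjMatrix ℝ) (treePoly k (i + 1)) u v =
      if G.dist u v = i + 1 then (cNum G (i + 1) u v : ℝ) else 0 := by
  induction i with
  | zero =>
    have h0 : ∀ u v, aeval (G.adjMatrix ℝ) (treePoly k 0) u v =
        if G.dist u v = 0 then 1 else 0 := by
      intro u v
      simp [treePoly, Matrix.one_apply, hconn.dist_eq_zero_iff]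
    refine ⟨h0, fun u v => ?_⟩
    rw [show treePoly k (0 + 1) = X * treePoly k 0 by simp [treePoly],
      aeval_X_mul_apply_of_indicator (h0 u)]
    split_ifs with h
    · rfl
    · rw [Nat.cast_eq_zero]
      rcases Nat.eq_zero_or_pos (G.dist u v) with h1 | h1
      · exact aNum_eq_zero hconn hg hi h1
      · exact card_sphere_inter_eq_zero hconn (Or.inl (by omega))
  | succ i ih =>
    obtain ⟨ih1, ih2⟩ := ih (by omega)
    have h1 : ∀ u v, aeval (G.adjMatrix ℝ) (treePoly k (i + 1)) u v =
        if G.dist u v = i + 1 then 1 else 0 := by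
      intro u v
      rw [ih2]
      split_ifs with h
      · rw [cNum_eq_one hconn hg hi h, Nat.cast_one]
      · rfl
    refine ⟨h1, fun u v => ?_⟩
    rw [show treePoly k (i + 1 + 1) = X * treePoly k (i + 1) -
      C (if i = 0 then (k : ℝ) else k - 1) * treePoly k i from rfl, map_sub, Matrix.sub_apply,
      aeval_X_mul_apply_of_indicator (h1 u), map_mul, aeval_C, Algebra.algebraMap_eq_smul_one,
      smul_mul_assoc, one_mul, Matrix.smul_apply, ih1, smul_eq_mul]
    by_cases h : G.dist u v = i
    · have hk := cNum_add_aNum_add_bNum hconn hreg h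
      rw [aNum_eq_zero hconn hg (by omega) h, bNum] at hk
      rw [if_pos h, if_neg (show ¬ G.dist u v = i + 1 + 1 by omega), mul_one, sub_eq_zero]
      cases i with
      | zero => simpa [cNum] using hk
      | succ i =>
        rw [cNum_eq_one hconn hg (by omega) h] at hk
        rw [if_neg (by omega), ← hk]
        push_cast
        ring
    · rw [if_neg h, mul_zero, sub_zero]
      split_ifs with h2
      · rfl
      · rw [Nat.cast_eq_zero]
        by_cases h3 : G.dist u v = i + 1
        · exact aNum_eq_zero hconn hg hi h3
        · exact card_sphere_inter_eq_zero hconn (by omega)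

lemma aeval_treePoly {i : ℕ} (hi : i ≤ m) (u v : V) :
    aeval (G.adjMatrix ℝ) (treePoly k i) u v = if G.dist u v = i then 1 else 0 :=
  (aeval_treePoly_aux hconn hreg hg i hi).1 u v

lemma aeval_treePoly_succ (u v : V) :
    aeval (G.adjMatrix ℝ) (treePoly k (m + 1)) u v =
      if G.dist u v = m + 1 then (cNum G (m + 1) u v : ℝ) else 0 :=
  (aeval_treePoly_aux hconn hreg hg m le_rfl).2 u v

omit hconn hreg hg in
/-- A polynomial whose value at the adjacency matrix is supported on the pairs at distance `i` is
orthogonal to all polynomials of smaller degree. -/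
lemma scalarProd_eq_zero_of_support {p q : ℝ[X]} {i : ℕ}
    (hp : ∀ u v, G.dist u v ≠ i → aeval (G.adjMatrix ℝ) p u v = 0) (hq : q.degree < i) :
    scalarProd G p q = 0 := by
  rw [scalarProd_eq_sum, Finset.sum_eq_zero, zero_div]
  refine fun u _ => Finset.sum_eq_zero fun v _ => ?_
  by_cases h : G.dist u v = i
  · rw [aeval_adjMatrix_apply_eq_zero (p := q) (by rwa [h]), mul_zero]
  · rw [hp u v h, zero_mul]

lemma treePoly_eq_monicOrtho {d i : ℕ} (heig : (eigenvalueSet G).ncard = d + 1) (hi : i ≤ m + 1)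
    (hid : i ≤ d) : treePoly k i = monicOrtho G i := by
  have : Nonempty V := hconn.nonempty
  refine eq_monicOrtho_of_orthogonal heig hid
    ((treePoly_sub_X_pow_degree_lt k i).trans_le (by exact_mod_cast Nat.sub_le i 1)) fun q hq => ?_
  refine scalarProd_eq_zero_of_support (fun u v h => ?_) hq
  rcases hi.eq_or_lt with rfl | hi
  · rw [aeval_treePoly_succ hconn hreg hg, if_neg h]
  · rw [aeval_treePoly hconn hreg hg (by omega), if_neg h]

end TreePoly

/-! ### Preintersection numbers through monic polynomials -/

section Preintersection

variable {G : SimpleGraph V} [DecidableRel G.Adj] {k d : ℕ}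

lemma degree_X_mul_monicOrtho_sub_lt (i : ℕ) :
    (X * monicOrtho G i - monicOrtho G (i + 1)).degree < ((i + 1 : ℕ) : WithBot ℕ) := by
  have hmon : (X * monicOrtho G i).Monic := monic_X.mul (monicOrtho_monic G i)
  have hdeg : (X * monicOrtho G i).degree = ((i + 1 : ℕ) : WithBot ℕ) := by
    rw [degree_mul, degree_X, monicOrtho_degree, add_comm]
    rfl
  refine (degree_sub_lt_left ?_ hmon.ne_zero ?_).trans_eq hdeg
  · rw [hdeg, monicOrtho_degree]
  · rw [hmon.leadingCoeff, (monicOrtho_monic G (i + 1)).leadingCoeff]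

variable [Nonempty V] (hreg : G.IsRegularOfDegree k) (heig : (eigenvalueSet G).ncard = d + 1)
include hreg heig

lemma preGamma_succ {i : ℕ} (hi : i + 1 ≤ d) :
    preGamma G (i + 1) = predistanceScale G i / predistanceScale G (i + 1) := by
  have hs := predistanceScale_ne_zero hreg heig hi
  have hq := (scalarProd_monicOrtho_self_pos heig hi).ne'
  have h : scalarProd G (X * monicOrtho G i) (monicOrtho G (i + 1)) =
      scalarProd G (monicOrtho G (i + 1)) (monicOrtho G (i + 1)) := by
    rw [← sub_eq_zero, ← scalarProd_sub_left, scalarProd_comm]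
    exact scalarProd_monicOrtho_of_degree_lt heig hi (degree_X_mul_monicOrtho_sub_lt i)
  rw [preGamma, predistancePoly_eq, predistancePoly_eq, mul_left_comm]
  simp only [scalarProd_C_mul_left, scalarProd_C_mul_right, h]
  field_simp

lemma preAlpha_eq {i : ℕ} (hi : i ≤ d) :
    preAlpha G i = scalarProd G (X * monicOrtho G i) (monicOrtho G i) /
      scalarProd G (monicOrtho G i) (monicOrtho G i) := by
  have hs := predistanceScale_ne_zero hreg heig hi
  have hq := (scalarProd_monicOrtho_self_pos heig hi).ne'
  rw [preAlpha, predistancePoly_eq, mul_left_comm]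
  simp only [scalarProd_C_mul_left, scalarProd_C_mul_right]
  field_simp

lemma degree_monicOrtho_recurrence_lt {i : ℕ} (hi : i + 1 ≤ d) :
    (X * monicOrtho G i - monicOrtho G (i + 1) - C (preAlpha G i) * monicOrtho G i).degree <
      ((i : ℕ) : WithBot ℕ) := by
  have hi' : i ≤ d := by omega
  refine degree_lt_of_scalarProd_eq_zero heig hi' ?_ ?_
  · refine (degree_sub_le _ _).trans_lt (max_lt (degree_X_mul_monicOrtho_sub_lt i) ?_)
    exact (degree_C_mul_le _ _).trans_lt
      ((monicOrtho_degree G i).trans_lt (Nat.cast_lt.2 i.lt_succ_self))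
  · rw [scalarProd_sub_left, scalarProd_sub_left, scalarProd_C_mul_left, preAlpha_eq hreg heig hi',
      div_mul_cancel₀ _ (scalarProd_monicOrtho_self_pos heig hi').ne',
      scalarProd_monicOrtho_of_lt heig hi i.lt_succ_self]
    ring

/-- The top monic orthogonal polynomial, evaluated through the Hoffman polynomial. -/
lemma aeval_monicOrtho_top (hconn : G.Connected) {e : ℕ} (he : d = e + 1) {u v : V}
    (h : e ≤ G.dist u v) :
    aeval (G.adjMatrix ℝ) (monicOrtho G d) u v = (predistanceScale G d)⁻¹ *
      (1 - predistanceScale G e * aeval (G.adjMatrix ℝ) (monicOrtho G e) u v) := by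
  have h1 := aeval_sum_predistancePoly hreg heig hconn u v
  have hs := predistanceScale_ne_zero hreg heig le_rfl
  subst he
  rw [Finset.sum_range_succ, Finset.sum_range_succ, map_add, map_add, Matrix.add_apply,
    Matrix.add_apply, aeval_adjMatrix_apply_eq_zero
      ((degree_sum_predistancePoly_lt e).trans_le (by exact_mod_cast h)), zero_add,
    predistancePoly_eq, predistancePoly_eq] at h1
  simp only [map_mul, aeval_C, Algebra.algebraMap_eq_smul_one, smul_mul_assoc, one_mul,
    Matrix.smul_apply, smul_eq_mul] at h1
  rw [eq_inv_mul_iff_mul_eq₀ hs]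
  linarith

end Preintersection

/-! ### Double counting -/

section Sums

omit [DecidableEq V] in
lemma sum_sum_dist_ite (G : SimpleGraph V) (i : ℕ) (f : V → V → ℝ) :
    ∑ u, ∑ v, (if G.dist u v = i then f u v else 0) = ∑ x ∈ distPairs G i, f x.1 x.2 := by
  rw [distPairs, Finset.sum_filter, Fintype.sum_prod_type]

/-- For fixed `u`, adjacency within the sphere of radius `i` is symmetric, so `v` and `w` may be
exchanged. -/
lemma sum_distPairs_aNum_mul (G : SimpleGraph V) [DecidableRel G.Adj] (i : ℕ) (f : V → V → ℝ) :
    ∑ x ∈ distPairs G i, ∑ w ∈ G.neighborFinset x.2, (if G.dist x.1 w = i then f x.1 w else 0) =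
      ∑ x ∈ distPairs G i, (aNum G i x.1 x.2 : ℝ) * f x.1 x.2 := by
  rw [← sum_sum_dist_ite G i fun u v => ∑ w ∈ G.neighborFinset v,
      (if G.dist u w = i then f u w else 0),
    ← sum_sum_dist_ite G i fun u v => (aNum G i u v : ℝ) * f u v]
  refine Finset.sum_congr rfl fun u _ => ?_
  have h1 : ∀ v, (if G.dist u v = i then ∑ w ∈ G.neighborFinset v,
      (if G.dist u w = i then f u w else 0) else 0) =
      ∑ w, if G.dist u v = i ∧ G.dist u w = i ∧ G.Adj v w then f u w else 0 := by
    intro v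
    split_ifs with h
    · rw [← Finset.sum_filter, ← Finset.sum_filter]
      refine Finset.sum_congr ?_ fun _ _ => rfl
      ext w
      simp [h, and_comm]
    · simp [h]
  have h2 : ∀ v, (if G.dist u v = i then (aNum G i u v : ℝ) * f u v else 0) =
      ∑ w, if G.dist u w = i ∧ G.dist u v = i ∧ G.Adj w v then f u v else 0 := by
    intro v
    split_ifs with h
    · rw [← Finset.sum_filter, Finset.sum_const, nsmul_eq_mul, aNum]
      congr 3
      ext w
      rw [mem_sphere_inter, Finset.mem_filter, G.adj_comm w v]
      simp [h]
    · simp [h]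
  simp_rw [h1, h2]
  exact Finset.sum_comm

end Sums

/-! ### Criteria for distance-regularity -/

section DistanceRegular

variable {G : SimpleGraph V}

lemma isDistanceRegular_of_wellDefinedAt [DecidableRel G.Adj] {k : ℕ} (hconn : G.Connected)
    (hreg : G.IsRegularOfDegree k) (hc : ∀ i, WellDefinedAt G i (cNum G i))
    (ha : ∀ i, WellDefinedAt G i (aNum G i)) : IsDistanceRegular G := by
  refine ⟨hconn, fun i => ⟨hc i, ha i, fun u v u' v' h h' => ?_⟩⟩
  have h1 := cNum_add_aNum_add_bNum hconn hreg h
  have h2 := cNum_add_aNum_add_bNum hconn hreg h'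
  rw [hc i u v u' v' h h', ha i u v u' v' h h'] at h1
  omega

lemma bNum_eq_zero {d : ℕ} (hdiam : ∀ u v, G.dist u v ≤ d) (u v : V) : bNum G d u v = 0 := by
  rw [bNum, Finset.card_eq_zero, Finset.eq_empty_iff_forall_notMem]
  intro w hw
  have := hdiam u w
  have := (mem_sphere_inter.1 hw).1
  omega

lemma wellDefinedAt_aNum_of_diam [DecidableRel G.Adj] {k d : ℕ} (hconn : G.Connected)
    (hreg : G.IsRegularOfDegree k) (hdiam : ∀ u v, G.dist u v ≤ d)
    (hc : WellDefinedAt G d (cNum G d)) : WellDefinedAt G d (aNum G d) := by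
  intro u v u' v' h h'
  have h1 := cNum_add_aNum_add_bNum hconn hreg h
  have h2 := cNum_add_aNum_add_bNum hconn hreg h'
  rw [bNum_eq_zero hdiam, hc u v u' v' h h'] at h1
  rw [bNum_eq_zero hdiam] at h2
  omega

omit [Fintype V] [DecidableEq V] in
lemma wellDefinedAt_of_diam_lt {d i : ℕ} (hdiam : ∀ u v, G.dist u v ≤ d) (hi : d < i)
    (f : V → V → ℕ) : WellDefinedAt G i f := fun u v _ _ h _ => by
  have := hdiam u v
  omega

lemma aNum_zero (hconn : G.Connected) {u v : V} (h : G.dist u v = 0) : aNum G 0 u v = 0 := by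
  rw [aNum, Finset.card_eq_zero, Finset.eq_empty_iff_forall_notMem]
  intro w hw
  rw [mem_sphere_inter, hconn.dist_eq_zero_iff] at hw
  rw [hconn.dist_eq_zero_iff] at h
  exact hw.2.ne (h.symm.trans hw.1)

lemma cNum_one (hconn : G.Connected) {u v : V} (h : G.dist u v = 1) : cNum G 1 u v = 1 := by
  refine le_antisymm (Finset.card_le_one.2 fun w hw w' hw' => ?_) (cNum_pos hconn h)
  rw [mem_sphere_inter, hconn.dist_eq_zero_iff] at hw hw'
  exact hw.1.symm.trans hw'.1

lemma isDistanceRegular_of_dist_le_one [DecidableRel G.Adj] {k : ℕ} (hconn : G.Connected)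
    (hreg : G.IsRegularOfDegree k) (hdiam : ∀ u v, G.dist u v ≤ 1) : IsDistanceRegular G := by
  have hc : ∀ i, WellDefinedAt G i (cNum G i) := by
    intro i
    match i with
    | 0 => exact fun _ _ _ _ _ _ => rfl
    | 1 => exact fun u v u' v' h h' => by rw [cNum_one hconn h, cNum_one hconn h']
    | i + 2 => exact wellDefinedAt_of_diam_lt hdiam (by omega) _
  refine isDistanceRegular_of_wellDefinedAt hconn hreg hc fun i => ?_
  match i with
  | 0 => exact fun u v u' v' h h' => by rw [aNum_zero hconn h, aNum_zero hconn h']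
  | 1 => exact wellDefinedAt_aNum_of_diam hconn hreg hdiam (hc 1)
  | i + 2 => exact wellDefinedAt_of_diam_lt hdiam (by omega) _

lemma avgAC_zero : avgAC G 0 = 0 := by simp [avgAC, cNum]

end DistanceRegular

/-! ### The case `d = m + 2` -/

section LargeGirth

variable {G : SimpleGraph V} [DecidableRel G.Adj] {k m : ℕ} (hconn : G.Connected)
  (hreg : G.IsRegularOfDegree k) (heig : (eigenvalueSet G).ncard = m + 2 + 1)
  (hg : ((2 * m + 2 : ℕ) : ℕ∞) ≤ G.egirth)
include hconn hreg heig hg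

lemma aeval_monicOrtho_succ (u v : V) : aeval (G.adjMatrix ℝ) (monicOrtho G (m + 1)) u v =
    if G.dist u v = m + 1 then (cNum G (m + 1) u v : ℝ) else 0 := by
  rw [← treePoly_eq_monicOrtho hconn hreg hg heig le_rfl (by omega),
    aeval_treePoly_succ hconn hreg hg]

/-- `q_m(A)` is a 0-1 matrix, so its squared norm is its average row sum `q_m(k)`. -/
lemma predistanceScale_eq_one : predistanceScale G m = 1 := by
  have : Nonempty V := hconn.nonempty
  have hn : (Fintype.card V : ℝ) ≠ 0 := by exact_mod_cast Fintype.card_ne_zero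
  have h : ∀ u v, aeval (G.adjMatrix ℝ) (monicOrtho G m) u v =
      if G.dist u v = m then 1 else 0 := by
    rw [← treePoly_eq_monicOrtho hconn hreg hg heig (by omega) (by omega)]
    exact aeval_treePoly hconn hreg hg le_rfl
  rw [predistanceScale, topEigenvalue_eq hreg, div_eq_one_iff_eq
    (scalarProd_monicOrtho_self_pos heig (by omega)).ne', scalarProd_eq_sum, eq_div_iff hn]
  have h1 : ∀ u v, aeval (G.adjMatrix ℝ) (monicOrtho G m) u v *
      aeval (G.adjMatrix ℝ) (monicOrtho G m) u v = aeval (G.adjMatrix ℝ) (monicOrtho G m) u v := by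
    intro u v
    rw [h]
    split_ifs <;> simp
  simp_rw [h1, aeval_adjMatrix_row_sum hreg]
  simp [mul_comm]

lemma preGamma_eq_inv : preGamma G (m + 1) = (predistanceScale G (m + 1))⁻¹ := by
  have : Nonempty V := hconn.nonempty
  rw [preGamma_succ hreg heig (by omega), predistanceScale_eq_one hconn hreg heig hg, one_div]

lemma predistanceScale_top_inv :
    (predistanceScale G (m + 2))⁻¹ = preGamma G (m + 2) * preGamma G (m + 1) := by
  have : Nonempty V := hconn.nonempty
  have := predistanceScale_ne_zero hreg heig (i := m + 1) (by omega)
  rw [preGamma_eq_inv hconn hreg heig hg, preGamma_succ hreg heig le_rfl]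
  field_simp

/-- The second moment of the numbers `c_{d-1}(u,v)` is `γ_{d-1}` times the first moment. -/
lemma sum_cNum_sq : ∑ x ∈ distPairs G (m + 1), (cNum G (m + 1) x.1 x.2 : ℝ) ^ 2 =
    preGamma G (m + 1) * ∑ x ∈ distPairs G (m + 1), (cNum G (m + 1) x.1 x.2 : ℝ) := by
  have : Nonempty V := hconn.nonempty
  have hn : (Fintype.card V : ℝ) ≠ 0 := by exact_mod_cast Fintype.card_ne_zero
  have hs := scalarProd_eq_sum G (monicOrtho G (m + 1)) (monicOrtho G (m + 1))
  have hr : ∑ u, ∑ v, aeval (G.adjMatrix ℝ) (monicOrtho G (m + 1)) u v =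
      Fintype.card V * (monicOrtho G (m + 1)).eval (k : ℝ) := by
    simp_rw [aeval_adjMatrix_row_sum hreg]
    simp
  simp_rw [aeval_monicOrtho_succ hconn hreg heig hg] at hs hr
  have h1 : ∀ u v, (if G.dist u v = m + 1 then (cNum G (m + 1) u v : ℝ) else 0) *
      (if G.dist u v = m + 1 then (cNum G (m + 1) u v : ℝ) else 0) =
      if G.dist u v = m + 1 then (cNum G (m + 1) u v : ℝ) ^ 2 else 0 := by
    intro u v
    split_ifs <;> ring
  simp_rw [h1] at hs
  rw [sum_sum_dist_ite G _ fun u v => (cNum G (m + 1) u v : ℝ) ^ 2, eq_div_iff hn] at hs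
  rw [sum_sum_dist_ite G _ fun u v => (cNum G (m + 1) u v : ℝ)] at hr
  have h2 := eval_monicOrtho_ne_zero hreg heig (i := m + 1) (by omega)
  rw [← hs, hr, preGamma_eq_inv hconn hreg heig hg, predistanceScale, topEigenvalue_eq hreg]
  field_simp

lemma distPairs_nonempty : (distPairs G (m + 1)).Nonempty := by
  have : Nonempty V := hconn.nonempty
  by_contra h
  rw [Finset.not_nonempty_iff_eq_empty] at h
  refine aeval_adjMatrix_ne_zero heig (monicOrtho_monic G (m + 1)).ne_zero
    ((monicOrtho_natDegree G (m + 1)).trans_le (by omega)) ?_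
  ext u v
  rw [aeval_monicOrtho_succ hconn hreg heig hg, if_neg]
  · rfl
  · intro huv
    have : (u, v) ∈ distPairs G (m + 1) := by simp [distPairs, huv]
    simp [h] at this

lemma sum_cNum_pos : 0 < ∑ x ∈ distPairs G (m + 1), (cNum G (m + 1) x.1 x.2 : ℝ) := by
  refine Finset.sum_pos (fun x hx => ?_) (distPairs_nonempty hconn hreg heig hg)
  have hx : G.dist x.1 x.2 = m + 1 := by simpa [distPairs] using hx
  exact_mod_cast cNum_pos hconn hx

lemma preGamma_pos : 0 < preGamma G (m + 1) := by
  refine pos_of_mul_pos_left ?_ (sum_cNum_pos hconn hreg heig hg).le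
  rw [← sum_cNum_sq hconn hreg heig hg]
  refine Finset.sum_pos (fun x hx => ?_) (distPairs_nonempty hconn hreg heig hg)
  have hx : G.dist x.1 x.2 = m + 1 := by simpa [distPairs] using hx
  have : (0 : ℝ) < cNum G (m + 1) x.1 x.2 := by exact_mod_cast cNum_pos hconn hx
  positivity

/-- In `x q_{d-1} = q_d + α_{d-1} q_{d-1} + …` the remainder has degree below `d - 1` and drops out,
while the Hoffman identity evaluates `q_d(A)`. -/
lemma aeval_X_mul_monicOrtho {u v : V} (h : m + 1 ≤ G.dist u v) :
    aeval (G.adjMatrix ℝ) (X * monicOrtho G (m + 1)) u v =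
      preAlpha G (m + 1) * aeval (G.adjMatrix ℝ) (monicOrtho G (m + 1)) u v +
      preGamma G (m + 2) *
        (preGamma G (m + 1) - aeval (G.adjMatrix ℝ) (monicOrtho G (m + 1)) u v) := by
  have : Nonempty V := hconn.nonempty
  have h1 := aeval_adjMatrix_apply_eq_zero (u := u) (v := v)
    ((degree_monicOrtho_recurrence_lt hreg heig (i := m + 1) le_rfl).trans_le
      (by exact_mod_cast h))
  have h2 := aeval_monicOrtho_top hreg heig hconn rfl h
  have hs := predistanceScale_ne_zero hreg heig (i := m + 1) (by omega)
  rw [predistanceScale_top_inv hconn hreg heig hg] at h2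
  rw [map_sub, map_sub, map_mul _ (C _), aeval_C, Algebra.algebraMap_eq_smul_one, smul_mul_assoc,
    one_mul, Matrix.sub_apply, Matrix.sub_apply, Matrix.smul_apply, smul_eq_mul, h2,
    preGamma_eq_inv hconn hreg heig hg] at h1
  rw [preGamma_eq_inv hconn hreg heig hg]
  field_simp at h1 ⊢
  linarith

lemma aeval_X_mul_monicOrtho_of_dist_eq {u v : V} (h : G.dist u v = m + 1) :
    aeval (G.adjMatrix ℝ) (X * monicOrtho G (m + 1)) u v =
      (preAlpha G (m + 1) - preGamma G (m + 2)) * cNum G (m + 1) u v +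
      preGamma G (m + 2) * preGamma G (m + 1) := by
  rw [aeval_X_mul_monicOrtho hconn hreg heig hg h.ge, aeval_monicOrtho_succ hconn hreg heig hg,
    if_pos h]
  ring

lemma sum_aNum_mul_cNum :
    ∑ x ∈ distPairs G (m + 1), (aNum G (m + 1) x.1 x.2 : ℝ) * cNum G (m + 1) x.1 x.2 =
      (preAlpha G (m + 1) - preGamma G (m + 2)) *
        (∑ x ∈ distPairs G (m + 1), (cNum G (m + 1) x.1 x.2 : ℝ)) +
      (distPairs G (m + 1)).card * (preGamma G (m + 2) * preGamma G (m + 1)) := by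
  rw [← sum_distPairs_aNum_mul G (m + 1) fun u v => (cNum G (m + 1) u v : ℝ), Finset.mul_sum,
    ← nsmul_eq_mul, ← Finset.sum_const, ← Finset.sum_add_distrib]
  refine Finset.sum_congr rfl fun x hx => ?_
  have hx : G.dist x.1 x.2 = m + 1 := by simpa [distPairs] using hx
  rw [← aeval_X_mul_monicOrtho_of_dist_eq hconn hreg heig hg hx, mul_comm X, map_mul, aeval_X,
    SimpleGraph.mul_adjMatrix_apply]
  simp_rw [aeval_monicOrtho_succ hconn hreg heig hg]

/-- The deviation of the average of `a_{d-1} c_{d-1}` is governed by the variance of the numbers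
`c_{d-1}(u,v)` around `γ_{d-1}`. -/
lemma avgAC_sub : avgAC G (m + 1) - preAlpha G (m + 1) * preGamma G (m + 1) =
    (preGamma G (m + 2) - preAlpha G (m + 1)) *
      ((∑ x ∈ distPairs G (m + 1), ((cNum G (m + 1) x.1 x.2 : ℝ) - preGamma G (m + 1)) ^ 2) /
        (preGamma G (m + 1) * (distPairs G (m + 1)).card)) := by
  have hN : ((distPairs G (m + 1)).card : ℝ) ≠ 0 := by
    exact_mod_cast (distPairs_nonempty hconn hreg heig hg).card_pos.ne'
  have hγ := (preGamma_pos hconn hreg heig hg).ne'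
  have hvar : ∑ x ∈ distPairs G (m + 1),
      ((cNum G (m + 1) x.1 x.2 : ℝ) - preGamma G (m + 1)) ^ 2 =
      preGamma G (m + 1) * ((distPairs G (m + 1)).card * preGamma G (m + 1) -
        ∑ x ∈ distPairs G (m + 1), (cNum G (m + 1) x.1 x.2 : ℝ)) := by
    have hsq : ∀ x : ℝ, (x - preGamma G (m + 1)) ^ 2 =
        x ^ 2 - 2 * preGamma G (m + 1) * x + preGamma G (m + 1) ^ 2 := fun x => by ring
    simp_rw [hsq]
    rw [Finset.sum_add_distrib, Finset.sum_sub_distrib, sum_cNum_sq hconn hreg heig hg,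
      ← Finset.mul_sum, Finset.sum_const, nsmul_eq_mul]
    ring
  rw [avgAC, sum_aNum_mul_cNum hconn hreg heig hg, hvar]
  field_simp
  ring

lemma isDistanceRegular_of_cNum_eq
    (hc : ∀ u v, G.dist u v = m + 1 → (cNum G (m + 1) u v : ℝ) = preGamma G (m + 1)) :
    IsDistanceRegular G := by
  have hγ := (preGamma_pos hconn hreg heig hg).ne'
  have hdiam := dist_le_of_ncard_eigenvalueSet hconn hreg heig
  have hind : ∀ u v, aeval (G.adjMatrix ℝ) (C (preGamma G (m + 1))⁻¹ * monicOrtho G (m + 1)) u v =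
      if G.dist u v = m + 1 then 1 else 0 := by
    intro u v
    rw [map_mul, aeval_C, Algebra.algebraMap_eq_smul_one, smul_mul_assoc, one_mul,
      Matrix.smul_apply, aeval_monicOrtho_succ hconn hreg heig hg, smul_eq_mul]
    split_ifs with h
    · rw [hc u v h, inv_mul_cancel₀ hγ]
    · rw [mul_zero]
  have hcard : ∀ u v, ((sphere G (m + 1) u ∩ sphere G 1 v).card : ℝ) =
      (preGamma G (m + 1))⁻¹ * aeval (G.adjMatrix ℝ) (X * monicOrtho G (m + 1)) u v := by
    intro u v
    rw [← aeval_X_mul_apply_of_indicator (hind u), mul_left_comm, map_mul, aeval_C,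
      Algebra.algebraMap_eq_smul_one, smul_mul_assoc, one_mul, Matrix.smul_apply, smul_eq_mul]
  have hcwd : ∀ i, WellDefinedAt G i (cNum G i) := by
    intro i u v u' v' h h'
    rcases i with _ | i
    · rfl
    rcases lt_trichotomy i m with hi | rfl | hi
    · rw [cNum_eq_one hconn hg hi h, cNum_eq_one hconn hg hi h']
    · have h1 := (hc u v h).trans (hc u' v' h').symm
      exact_mod_cast h1
    rcases (Nat.succ_le_of_lt hi).eq_or_lt with rfl | hi
    -- At distance `d` the entry of `q_{d-1}(A)` is 0, leaving only `γ_d γ_{d-1}`.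
    · have h1 : ∀ u v, G.dist u v = m + 1 + 1 →
          ((cNum G (m + 1 + 1) u v : ℕ) : ℝ) = preGamma G (m + 2) := by
        intro u v h
        rw [cNum, hcard, aeval_X_mul_monicOrtho hconn hreg heig hg (by omega),
          aeval_monicOrtho_succ hconn hreg heig hg, if_neg (by omega)]
        field_simp
        ring
      exact_mod_cast (h1 u v h).trans (h1 u' v' h').symm
    · have := hdiam u v
      omega
  refine isDistanceRegular_of_wellDefinedAt hconn hreg hcwd fun i => ?_
  rcases le_or_gt i m with hi | hi
  · exact fun u v u' v' h h' => by rw [aNum_eq_zero hconn hg hi h, aNum_eq_zero hconn hg hi h']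
  rcases (Nat.succ_le_of_lt hi).eq_or_lt with rfl | hi
  · intro u v u' v' h h'
    have h1 : (aNum G (m + 1) u v : ℝ) = aNum G (m + 1) u' v' := by
      rw [aNum, aNum, hcard, hcard, aeval_X_mul_monicOrtho_of_dist_eq hconn hreg heig hg h,
        aeval_X_mul_monicOrtho_of_dist_eq hconn hreg heig hg h', hc u v h, hc u' v' h']
    exact_mod_cast h1
  rcases (Nat.succ_le_of_lt hi).eq_or_lt with rfl | hi
  · exact wellDefinedAt_aNum_of_diam hconn hreg hdiam (hcwd _)
  · exact wellDefinedAt_of_diam_lt hdiam hi _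

/-- If `c` is constant, the second moment identity forces the constant to be `γ_{d-1}`. -/
lemma isDistanceRegular_iff_sum_sq_eq_zero : IsDistanceRegular G ↔
    ∑ x ∈ distPairs G (m + 1), ((cNum G (m + 1) x.1 x.2 : ℝ) - preGamma G (m + 1)) ^ 2 = 0 := by
  rw [Finset.sum_eq_zero_iff_of_nonneg fun x _ => sq_nonneg _]
  constructor
  · intro h x hx
    have hmem : ∀ y ∈ distPairs G (m + 1),
        (cNum G (m + 1) y.1 y.2 : ℝ) = cNum G (m + 1) x.1 x.2 := by
      intro y hy
      simp only [distPairs, Finset.mem_filter, Finset.mem_univ, true_and] at hx hy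
      exact_mod_cast (h.2 (m + 1)).1 _ _ _ _ hy hx
    have h1 := sum_cNum_sq hconn hreg heig hg
    have h2 := sum_cNum_pos hconn hreg heig hg
    rw [Finset.sum_congr rfl fun y hy => by rw [hmem y hy, sq], ← Finset.mul_sum,
      ← Finset.sum_congr rfl hmem] at h1
    rw [mul_right_cancel₀ h2.ne' h1, sub_self, sq, zero_mul]
  · intro h
    refine isDistanceRegular_of_cNum_eq hconn hreg heig hg fun u v huv => ?_
    have := h (u, v) (by simp [distPairs, huv])
    rw [sq_eq_zero_iff, sub_eq_zero] at this
    exact this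

lemma adjMatrix_pow_apply {u v : V} (h : G.dist u v = m + 1) :
    (G.adjMatrix ℝ ^ (m + 2)) u v = aeval (G.adjMatrix ℝ) (X * monicOrtho G (m + 1)) u v := by
  have hdeg := treePoly_sub_X_pow_degree_lt k (m + 1)
  rw [treePoly_eq_monicOrtho hconn hreg hg heig le_rfl (by omega)] at hdeg
  have h1 : (X * (monicOrtho G (m + 1) - X ^ (m + 1))).degree < ((m + 1 : ℕ) : WithBot ℕ) := by
    rw [degree_lt_iff_coeff_zero] at hdeg ⊢
    intro j hj
    obtain ⟨j, rfl⟩ : ∃ l, j = l + 1 := ⟨j - 1, by omega⟩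
    rw [coeff_X_mul]
    exact hdeg j (by omega)
  have h2 := aeval_adjMatrix_apply_eq_zero (u := u) (v := v) (h1.trans_eq (by rw [h]))
  rw [mul_sub, ← pow_succ', map_sub, Matrix.sub_apply, sub_eq_zero, map_pow, aeval_X] at h2
  exact h2.symm

end LargeGirth

end PreInt

end

theorem mainTheorem7 {V : Type*} [Fintype V] [DecidableEq V] (G : SimpleGraph V)
    [DecidableRel G.Adj] (k d : ℕ)
    (hconn : G.Connected) (hreg : G.IsRegularOfDegree k)
    (hd : 1 ≤ d) (heig : (PreInt.eigenvalueSet G).ncard = d + 1)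
    (hgirth : ((2 * d - 2 : ℕ) : ℕ∞) ≤ G.egirth) :
    (PreInt.preAlpha G (d - 1) < PreInt.preGamma G d →
      PreInt.preAlpha G (d - 1) * PreInt.preGamma G (d - 1) ≤ PreInt.avgAC G (d - 1) ∧
      (PreInt.avgAC G (d - 1) = PreInt.preAlpha G (d - 1) * PreInt.preGamma G (d - 1) ↔
        PreInt.IsDistanceRegular G)) ∧
    (PreInt.preGamma G d < PreInt.preAlpha G (d - 1) →
      PreInt.avgAC G (d - 1) ≤ PreInt.preAlpha G (d - 1) * PreInt.preGamma G (d - 1) ∧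
      (PreInt.avgAC G (d - 1) = PreInt.preAlpha G (d - 1) * PreInt.preGamma G (d - 1) ↔
        PreInt.IsDistanceRegular G)) ∧
    (PreInt.preAlpha G (d - 1) = PreInt.preGamma G d →
      ∀ u v : V, G.dist u v = d - 1 →
        ((G.adjMatrix ℝ) ^ d) u v =
          PreInt.preAlpha G (d - 1) * PreInt.preGamma G (d - 1)) := by
  obtain rfl | ⟨m, rfl⟩ : d = 1 ∨ ∃ m, d = m + 2 := by
    rcases d with _ | _ | m
    · omega
    · exact Or.inl rfl
    · exact Or.inr ⟨m, rfl⟩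
  -- For `d = 1` the girth bound is void, but the diameter is at most 1, and both sides vanish since
  -- `γ_0 = 0` and `c_0 = 0`.
  · have hdrg : PreInt.IsDistanceRegular G := PreInt.isDistanceRegular_of_dist_le_one hconn hreg
      (PreInt.dist_le_of_ncard_eigenvalueSet hconn hreg heig)
    have hγ : PreInt.preGamma G (1 - 1) = 0 := rfl
    have hac : PreInt.avgAC G (1 - 1) = 0 := PreInt.avgAC_zero
    rw [hγ, hac, mul_zero]
    refine ⟨fun _ => ⟨le_rfl, by simp [hdrg]⟩, fun _ => ⟨le_rfl, by simp [hdrg]⟩,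
      fun _ u v huv => ?_⟩
    obtain rfl := hconn.dist_eq_zero_iff.1 huv
    simp
  · rw [show 2 * (m + 2) - 2 = 2 * m + 2 by omega] at hgirth
    rw [show m + 2 - 1 = m + 1 by omega]
    have hvar := PreInt.avgAC_sub hconn hreg heig hgirth
    have hγ := PreInt.preGamma_pos hconn hreg heig hgirth
    have hN : (0 : ℝ) < (PreInt.distPairs G (m + 1)).card := by
      exact_mod_cast (PreInt.distPairs_nonempty hconn hreg heig hgirth).card_pos
    have hden := mul_pos hγ hN
    have hnonneg := div_nonneg (Finset.sum_nonneg fun x (_ : x ∈ PreInt.distPairs G (m + 1)) =>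
      sq_nonneg ((PreInt.cNum G (m + 1) x.1 x.2 : ℝ) - PreInt.preGamma G (m + 1))) hden.le
    have hiff : PreInt.preGamma G (m + 2) - PreInt.preAlpha G (m + 1) ≠ 0 →
        (PreInt.avgAC G (m + 1) = PreInt.preAlpha G (m + 1) * PreInt.preGamma G (m + 1) ↔
          PreInt.IsDistanceRegular G) := by
      intro hne
      rw [PreInt.isDistanceRegular_iff_sum_sq_eq_zero hconn hreg heig hgirth, ← sub_eq_zero, hvar,
        mul_eq_zero, or_iff_right hne, div_eq_zero_iff, or_iff_left hden.ne']
    refine ⟨fun h => ⟨?_, hiff (by linarith)⟩, fun h => ⟨?_, hiff (by linarith)⟩,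
      fun h u v huv => ?_⟩
    · rw [← sub_nonneg, hvar]
      exact mul_nonneg (by linarith) hnonneg
    · rw [← sub_nonpos, hvar]
      exact mul_nonpos_of_nonpos_of_nonneg (by linarith) hnonneg
    · rw [PreInt.adjMatrix_pow_apply hconn hreg heig hgirth huv,
        PreInt.aeval_X_mul_monicOrtho_of_dist_eq hconn hreg heig hgirth huv, ← h]
      ring
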